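/- An affine $\mathbb{R}$-variety $V$ is a reduced, not necessarily irreducible, affine scheme of finite type over $\mathbb{R}$, with coordinate ring $\mathbb{R}[V]$; a closed subvariety $Z\subseteq V$ is a Zariski-closed subset with its reduced structure, $\mathcal{I}_Z\subseteq\mathbb{R}[V]$ denotes its vanishing ideal and $\mathbb{R}[Z]=\mathbb{R}[V]/\mathcal{I}_Z$. The set $V(\mathbb{R})$ of real points carries the euclidean topology, and a point of $V$ is called real if its residue field is $\mathbb{R}$. A function $f\in\mathbb{R}[V]$ is psd if $f(x)\ge 0$ for all $x\in V(\mathbb{R})$, and sos if it is a finite sum of squares in $\mathbb{R}[V]$; psd$=$sos in $\mathbb{R}[V]$ means that every psd function in $\mathbb{R}[V]$ is sos. A curve is a variety all of whose irreducible components have dimension $1$; if $C$ is an affine curve over $\mathbb{R}$, then $C(\mathbb{R})$ is called virtually compact if for every irreducible component $C_i$ of $C$ there is a function in $\mathbb{R}[C_i]\setminus\mathbb{R}$ that is bounded on $C_i(\mathbb{R})$. If two closed subvarieties $V_1,V_2$ of $V$ intersect in only finitely many points $P_1,\dots,P_r$ ($r\ge 0$), the intersection is called transversal if $\mathcal{I}_{V_1}+\mathcal{I}_{V_2}=\bigcap_{i=1}^r\mathfrak{m}_{P_i}$,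 where $\mathfrak{m}_{P}$ is the vanishing ideal of $P$ (the right-hand side being $\mathbb{R}[V]$ if $r=0$). **Proposition.** Let $V$ be an affine $\mathbb{R}$-variety that is the union of two closed subvarieties $V_1$ and $V_2$ with the following properties: 1. psd$=$sos in $\mathbb{R}[V_1]$; 2. $V_1(\mathbb{R})$ is compact, or $V_1$ is a curve and $V_1(\mathbb{R})$ is virtually compact; 3. the intersection of $V_1$ and $V_2$ is finite and transversal; 4. all points of $V_1\cap V_2$ are real. Then every psd function $f\in\mathbb{R}[V]$ whose restriction $f|_{V_2}$ is a sum of squares in $\mathbb{R}[V_2]$ is a sum of squares in $\mathbb{R}[V]$. -/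

import Mathlib

/-! An affine `ℝ`-variety `V` (reduced, not necessarily irreducible) is given by its coordinate ring
`A = ℝ[V]`, a reduced `ℝ`-algebra of finite type; the underlying space of `V` is `PrimeSpectrum A`.
A closed subvariety of `V` is a closed subset of `PrimeSpectrum A` with the reduced structure. -/

namespace RealVariety

section
universe u
variable (A : Type u) [CommRing A] [Algebra ℝ A]

/-- The set `V(ℝ)` of real points of `V = Spec A`, as `ℝ`-valued points. -/
def RealPoints : Type u := A →ₐ[ℝ] ℝ

variable {A}

/-- The value `f(x)` of a function `f ∈ ℝ[V]` at a real point `x ∈ V(ℝ)`. -/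
def RealPoints.value (x : RealPoints A) (f : A) : ℝ := (show A →ₐ[ℝ] ℝ from x) f

/-- The euclidean topology on `V(ℝ)`: the coarsest one for which every function `f ∈ ℝ[V]` is
continuous. It is induced by any closed embedding of `V` into an affine space. -/
instance RealPoints.instTopologicalSpace : TopologicalSpace (RealPoints A) :=
  TopologicalSpace.induced (fun (x : RealPoints A) (f : A) => x.value f) inferInstance

/-- `f` is psd: it is nonnegative on `V(ℝ)`. -/
def IsPsd (f : A) : Prop := ∀ x : RealPoints A, 0 ≤ x.value f

/-- `f` is sos: `f = f₁² + ⋯ + fₙ²` for some `n` and `fᵢ ∈ ℝ[V]`. -/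
def IsSos (f : A) : Prop := ∃ (n : ℕ) (g : Fin n → A), f = ∑ i, g i ^ 2

variable (A)

/-- psd = sos in `ℝ[V]`. -/
def PsdEqSos : Prop := ∀ f : A, IsPsd f → IsSos f

/-- The ring `B(V)` of functions that are bounded on `V(ℝ)`, as a subalgebra of `ℝ[V]`. -/
def boundedFunctions : Subalgebra ℝ A where
  carrier := {f | ∃ c : ℝ, ∀ x : RealPoints A, |x.value f| ≤ c}
  mul_mem' := by
    rintro f g ⟨c, hc⟩ ⟨d, hd⟩
    refine ⟨c * d, fun x => ?_⟩
    have h : x.value (f * g) = x.value f * x.value g := map_mul (show A →ₐ[ℝ] ℝ from x) f g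
    rw [h, abs_mul]
    exact mul_le_mul (hc x) (hd x) (abs_nonneg _) ((abs_nonneg _).trans (hc x))
  add_mem' := by
    rintro f g ⟨c, hc⟩ ⟨d, hd⟩
    refine ⟨c + d, fun x => ?_⟩
    have h : x.value (f + g) = x.value f + x.value g := map_add (show A →ₐ[ℝ] ℝ from x) f g
    rw [h]
    exact (abs_add_le _ _).trans (add_le_add (hc x) (hd x))
  algebraMap_mem' := by
    intro r
    refine ⟨|r|, fun x => ?_⟩
    have h : x.value (algebraMap ℝ A r) = r := (show A →ₐ[ℝ] ℝ from x).commutes r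
    rw [h]

variable {A}

/-- The coordinate ring `ℝ[Z] = ℝ[V] / I_Z` of the closed subvariety `Z` of `V = Spec A`. -/
abbrev CoordRing (Z : Set (PrimeSpectrum A)) : Type u := A ⧸ PrimeSpectrum.vanishingIdeal Z

/-- The restriction `f|_Z` of a function `f ∈ ℝ[V]` to the closed subvariety `Z`. -/
def restrict (Z : Set (PrimeSpectrum A)) (f : A) : CoordRing Z :=
  Ideal.Quotient.mk (PrimeSpectrum.vanishingIdeal Z) f

/-- A point of the scheme `V = Spec A` is real if its residue field is `ℝ`. -/
def IsRealPoint (P : PrimeSpectrum A) : Prop :=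
  Function.Bijective (algebraMap ℝ P.asIdeal.ResidueField)

/-- For closed subvarieties `Z₁`, `Z₂` with finite intersection `{P₁, …, Pᵣ}`: the intersection is
transversal if `I_{Z₁} + I_{Z₂} = 𝔪_{P₁} ∩ ⋯ ∩ 𝔪_{Pᵣ}` (all of `ℝ[V]` if `r = 0`). -/
def IsTransversal (Z₁ Z₂ : Set (PrimeSpectrum A)) : Prop :=
  PrimeSpectrum.vanishingIdeal Z₁ ⊔ PrimeSpectrum.vanishingIdeal Z₂ =
    ⨅ P ∈ Z₁ ∩ Z₂, P.asIdeal

variable (A)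

/-- `V = Spec A` is a curve: all its irreducible components have Krull dimension `1`. -/
def IsCurve : Prop :=
  ∀ Z ∈ irreducibleComponents (PrimeSpectrum A), ringKrullDim (CoordRing Z) = 1

/-- `V(ℝ)` is virtually compact (used for curves): `B(Z) ≠ ℝ` for every irreducible component `Z`
of `V`, i.e. every `Z` admits a nonconstant function that is bounded on `Z(ℝ)`. -/
def IsVirtuallyCompact : Prop :=
  ∀ Z ∈ irreducibleComponents (PrimeSpectrum A), boundedFunctions (CoordRing Z) ≠ ⊥

end

end RealVariety

namespace RealVariety

/-! By transversality and reality of the points `P`, functions on `V₁` and `V₂` that agree at every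
`P` glue to a function on `V`. If `f = ∑ g_k²` on `V₂`, it thus suffices to write `f = ∑ h_k² + ∑
s_l²` on `V₁` with `h_k(P) = g_k(P)`: comparing values forces `s_l(P) = 0`, so `h_k` glues with
`g_k` and `s_l` with `0`.

The `h_k` come from `exists_sum_sq_add_sum_sq_of_isPsd`. From `f = ∑ u_l²` on `V₁`, Cauchy-Schwarz
gives `w_j` with `f(P_j) w_j² ≤ f`, and `w_j(P_j) = 1` if `f(P_j) ≠ 0`. Given `p_j` with `p_j(P_i) =
δ_ij` and `∑ p_j² ≤ 1`, put `h_k = ∑ p_j² g_k(P_j) w_j`. Cauchy-Schwarz again gives `∑ h_k² ≤ f`,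
and the difference is psd, hence sos.

Such `p_j` exist once bounded functions separate the points. This is trivial if `V₁(ℝ)` is compact;
on a virtually compact curve it follows from Zariski's main theorem, since the bounded functions are
integrally closed. -/

theorem mem_boundedFunctions {A : Type*} [CommRing A] [Algebra ℝ A] {f : A} :
    f ∈ boundedFunctions A ↔ ∃ c : ℝ, ∀ x : A →ₐ[ℝ] ℝ, |x f| ≤ c := Iff.rfl

theorem isPsd_iff {A : Type*} [CommRing A] [Algebra ℝ A] {f : A} :
    IsPsd f ↔ ∀ x : A →ₐ[ℝ] ℝ, 0 ≤ x f := Iff.rfl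

/-! ### The ring of bounded functions -/

/-- Functions are bounded on a compact set of real points. -/
theorem boundedFunctions_eq_top_of_compactSpace {A : Type*} [CommRing A] [Algebra ℝ A]
    [CompactSpace (RealPoints A)] : boundedFunctions A = ⊤ := by
  refine eq_top_iff.2 fun f _ => ?_
  have hc : Continuous fun x : RealPoints A => |x.value f| :=
    ((continuous_apply f).comp continuous_induced_dom).abs
  obtain ⟨c, hc⟩ := (isCompact_range hc).bddAbove
  exact ⟨c, fun x => hc ⟨x, rfl⟩⟩

/-- The ring of bounded functions is integrally closed in the coordinate ring. -/
theorem mem_boundedFunctions_of_isIntegral {A : Type*} [CommRing A] [Algebra ℝ A] {y : A}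
    (hy : IsIntegral (boundedFunctions A) y) : y ∈ boundedFunctions A := by
  obtain ⟨p, hp, hpy⟩ := hy
  have hb : ∀ i, ∃ c : ℝ, ∀ x : A →ₐ[ℝ] ℝ, |x (p.coeff i : A)| ≤ c := fun i => (p.coeff i).2
  choose c hc using hb
  -- Cauchy's bound for the roots of a monic polynomial.
  refine ⟨1 + ∑ i ∈ Finset.range p.natDegree, |c i|, fun (x : A →ₐ[ℝ] ℝ) => ?_⟩
  change |x y| ≤ _
  by_contra! hlt
  have hsum : 0 ≤ ∑ i ∈ Finset.range p.natDegree, |c i| :=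
    Finset.sum_nonneg fun _ _ => abs_nonneg _
  have h1 : 1 ≤ |x y| := by linarith
  have heq : y ^ p.natDegree + ∑ i ∈ Finset.range p.natDegree, (p.coeff i : A) * y ^ i = 0 := by
    rw [Polynomial.eval₂_eq_sum_range, Finset.sum_range_succ] at hpy
    have : (p.coeff p.natDegree) = 1 := hp
    rw [this] at hpy
    rw [add_comm, ← hpy]
    simp
  have hx := congrArg x heq
  simp only [map_add, map_pow, map_sum, map_mul, map_zero] at hx
  obtain hn | ⟨n, hn⟩ : p.natDegree = 0 ∨ ∃ n, p.natDegree = n + 1 := by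
    cases p.natDegree <;> simp
  · simp [hn] at hx
  have hle : |x y| ^ (n + 1) ≤ (∑ i ∈ Finset.range p.natDegree, |c i|) * |x y| ^ n := by
    rw [← abs_pow, ← hn, eq_neg_of_add_eq_zero_left hx, abs_neg, Finset.sum_mul]
    refine (Finset.abs_sum_le_sum_abs _ _).trans (Finset.sum_le_sum fun i hi => ?_)
    rw [abs_mul, abs_pow]
    refine mul_le_mul ((hc i x).trans (le_abs_self _)) (pow_le_pow_right₀ h1 ?_)
      (by positivity) (abs_nonneg _)
    rw [Finset.mem_range] at hi
    omega
  rw [pow_succ'] at hle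
  have := le_of_mul_le_mul_right hle (by positivity)
  linarith

/-- A quotient in which every prime is maximal is finite-dimensional. -/
theorem finite_quotient_span_singleton {A : Type*} [CommRing A] [Algebra ℝ A]
    [Algebra.FiniteType ℝ A] {c : A} (hc : ∀ q : Ideal A, q.IsPrime → c ∈ q → q.IsMaximal) :
    Module.Finite ℝ (A ⧸ Ideal.span {c}) := by
  have hA : IsNoetherianRing A := Algebra.FiniteType.isNoetherianRing ℝ A
  rw [Module.finite_iff_isArtinianRing, isArtinianRing_iff_isNoetherianRing_krullDimLE_zero]
  refine ⟨inferInstance, Ring.KrullDimLE.mk₀ fun q hq => ?_⟩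
  have hs := Ideal.Quotient.mk_surjective (I := Ideal.span {c})
  have hm := hc (q.comap (Ideal.Quotient.mk (Ideal.span {c}))) inferInstance (by
    have : Ideal.Quotient.mk (Ideal.span {c}) c = 0 :=
      Ideal.Quotient.eq_zero_iff_mem.2 (Ideal.mem_span_singleton_self c)
    simp [Ideal.mem_comap, this])
  rw [← Ideal.map_comap_of_surjective _ hs q]
  refine (Ideal.map_eq_top_or_isMaximal_of_surjective _ hs hm).resolve_left fun h => hq.ne_top ?_
  rwa [Ideal.map_comap_of_surjective _ hs] at h

/-- A virtually compact irreducible curve has a transcendental bounded function. -/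
theorem exists_transcendental_mem_boundedFunctions {D : Type*} [CommRing D] [IsDomain D]
    [Algebra ℝ D] (hdim : ringKrullDim D = 1) (hB : boundedFunctions D ≠ ⊥) :
    ∃ b ∈ boundedFunctions D, Transcendental ℝ b := by
  by_contra! hall
  obtain ⟨b, hb, hb'⟩ : ∃ b ∈ boundedFunctions D, b ∉ (⊥ : Subalgebra ℝ D) := by
    by_contra! h
    exact hB (eq_bot_iff.2 h)
  have halg : IsIntegral ℝ b := (not_not.1 (hall b hb)).isIntegral
  -- At a real point, the irreducible minimal polynomial of `b` would have a real root and `b` would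
  -- be constant. Without real points every function is bounded, hence algebraic, and `D` is a
  -- field.
  have hempty : IsEmpty (D →ₐ[ℝ] ℝ) := by
    refine ⟨fun x => hb' ?_⟩
    have hroot : (minpoly ℝ b).IsRoot (x b) := by
      have h := congrArg x (minpoly.aeval ℝ b)
      rwa [← Polynomial.aeval_algHom_apply, map_zero, Polynomial.coe_aeval_eq_eval] at h
    exact Algebra.mem_bot.2 (minpoly.mem_range_of_degree_eq_one ℝ b
      (Polynomial.degree_eq_one_of_irreducible_of_root (minpoly.irreducible halg) hroot))
  have hint : Algebra.IsIntegral ℝ D :=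
    ⟨fun d => (not_not.1 (hall d ⟨0, fun x => (hempty.false x).elim⟩)).isIntegral⟩
  have hF : IsField D := isField_of_isIntegral_of_isField' (Field.toIsField ℝ)
  rw [ringKrullDim_eq_zero_of_isField hF] at hdim
  exact zero_ne_one hdim

/-! ### Interpolation with control of squares -/

/-- If bounded functions separate the members of a finite family of real points, then there are
bounded functions that interpolate there. -/
theorem exists_mem_boundedFunctions_interpolating {A : Type*} [CommRing A] [Algebra ℝ A]
    {ι : Type*} [Fintype ι] [DecidableEq ι] (χ : ι → A →ₐ[ℝ] ℝ)
    (hχ : ∀ i j, i ≠ j → ∃ b ∈ boundedFunctions A, χ i b ≠ χ j b) :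
    ∃ e : ι → A, (∀ j, e j ∈ boundedFunctions A) ∧
      ∀ i j, χ i (e j) = if i = j then 1 else 0 := by
  have h : ∀ i j, ∃ b ∈ boundedFunctions A, χ j b = 1 ∧ (i ≠ j → χ i b = 0) := by
    intro i j
    by_cases hij : i = j
    · exact ⟨1, one_mem _, by simp, by simp [hij]⟩
    obtain ⟨b, hb, hne⟩ := hχ i j hij
    refine ⟨algebraMap ℝ A (χ j b - χ i b)⁻¹ * (b - algebraMap ℝ A (χ i b)),
      mul_mem (algebraMap_mem _ _) (sub_mem hb (algebraMap_mem _ _)), ?_, fun _ => ?_⟩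
    · simp only [map_mul, map_sub, AlgHom.commutes, Algebra.algebraMap_self, RingHom.id_apply]
      exact inv_mul_cancel₀ (sub_ne_zero.2 hne.symm)
    · simp
  choose b hb h1 h0 using h
  refine ⟨fun j => ∏ i, b i j, fun j => prod_mem fun i _ => hb i j, fun i j => ?_⟩
  rw [map_prod]
  split_ifs with hij
  · subst hij
    exact Finset.prod_eq_one fun k _ => h1 k i
  · exact Finset.prod_eq_zero (Finset.mem_univ i) (h0 i j hij)

/-- Functions that interpolate at given real points and whose squares sum to at most one. -/
theorem exists_interpolating_sum_sq_le_one {A : Type*} [CommRing A] [Algebra ℝ A]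
    {ι : Type*} [Fintype ι] [DecidableEq ι] (χ : ι → A →ₐ[ℝ] ℝ)
    (hχ : ∀ i j, i ≠ j → ∃ b ∈ boundedFunctions A, χ i b ≠ χ j b) :
    ∃ p : ι → A, (∀ i j, χ i (p j) = if i = j then 1 else 0) ∧
      ∀ x : A →ₐ[ℝ] ℝ, ∑ j, x (p j) ^ 2 ≤ 1 := by
  obtain ⟨e, heB, he⟩ := exists_mem_boundedFunctions_interpolating χ hχ
  obtain ⟨K, hK⟩ := mem_boundedFunctions.1
    (sum_mem fun j (_ : j ∈ Finset.univ) => pow_mem (heB j) 2 : ∑ j, e j ^ 2 ∈ boundedFunctions A)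
  obtain ⟨m, hm⟩ := exists_nat_ge (max K 1)
  have hm1 : (1 : ℝ) ≤ m := (le_max_right _ _).trans hm
  have hmK : K ≤ m := (le_max_left _ _).trans hm
  -- With `T = ∑ e_j²`, the factor is a polynomial substitute for `exp(-(T - 1)/2)`, equal to `1`
  -- where `T = 1`. Then `∑ p_j² ≤ T exp(-(T - 1)) ≤ 1`; the choice `m ≥ T` keeps the base
  -- nonnegative.
  refine ⟨fun j => e j * (1 - algebraMap ℝ A (2 * m)⁻¹ * (∑ j, e j ^ 2 - 1)) ^ m,
    fun i j => ?_, fun x => ?_⟩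
  · have : χ i (∑ j, e j ^ 2) = 1 := by simp [he]
    rw [map_mul, map_pow, map_sub, map_mul, map_sub, this, he]
    simp
  · have hT : x (∑ j, e j ^ 2) = ∑ j, x (e j) ^ 2 := by simp
    have hTK := (le_abs_self _).trans (hK x)
    set T := x (∑ j, e j ^ 2) with hTdef
    have hT0 : 0 ≤ T := by rw [hT]; positivity
    have hval : ∀ j, x (e j * (1 - algebraMap ℝ A (2 * m)⁻¹ * (∑ j, e j ^ 2 - 1)) ^ m) ^ 2 =
        x (e j) ^ 2 * (1 - (T - 1) / (2 * m)) ^ (2 * m) := by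
      intro j
      rw [map_mul, map_pow, map_sub, map_mul, map_sub, ← hTdef, AlgHom.commutes, map_one, mul_pow,
        ← pow_mul, mul_comm m 2, div_eq_inv_mul]
      rfl
    simp only [hval]
    rw [← Finset.sum_mul, ← hT]
    have h0 : 0 ≤ 1 - (T - 1) / (2 * m) := by
      rw [sub_nonneg, div_le_one (by positivity)]
      linarith
    have h1 : T ≤ Real.exp (T - 1) := by linarith [Real.add_one_le_exp (T - 1)]
    have h2 : (1 - (T - 1) / (2 * m)) ^ (2 * m) ≤ Real.exp (-(T - 1)) := by
      refine (pow_le_pow_left₀ h0 (Real.one_sub_le_exp_neg _) _).trans_eq ?_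
      rw [← Real.exp_nat_mul]
      congr 1
      push_cast
      field_simp
    refine (mul_le_mul h1 h2 (by positivity) (Real.exp_pos _).le).trans_eq ?_
    rw [← Real.exp_add]
    simp

/-! ### Sums of squares with prescribed values -/

/-- A psd function on a variety with psd = sos is a sum of squares with prescribed values of the
first summands at finitely many real points that are separated by bounded functions. -/
theorem exists_sum_sq_add_sum_sq_of_isPsd {A : Type*} [CommRing A] [Algebra ℝ A]
    (hA : PsdEqSos A) {ι : Type*} [Fintype ι] [DecidableEq ι] (χ : ι → A →ₐ[ℝ] ℝ)
    (hχ : ∀ i j, i ≠ j → ∃ b ∈ boundedFunctions A, χ i b ≠ χ j b) {f : A} (hf : IsPsd f)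
    {κ : Type*} [Fintype κ] (g : κ → ι → ℝ) (hg : ∀ i, χ i f = ∑ k, g k i ^ 2) :
    ∃ (h : κ → A) (n : ℕ) (s : Fin n → A), f = ∑ k, h k ^ 2 + ∑ l, s l ^ 2 ∧
      ∀ k i, χ i (h k) = g k i := by
  obtain ⟨N, u, hu⟩ := hA f hf
  rw [isPsd_iff] at hf
  obtain ⟨p, hp, hp1⟩ := exists_interpolating_sum_sq_le_one χ hχ
  have hw : ∀ j, ∃ w : A, (χ j f ≠ 0 → χ j w = 1) ∧ ∀ x : A →ₐ[ℝ] ℝ, χ j f * x w ^ 2 ≤ x f := by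
    intro j
    by_cases h0 : χ j f = 0
    · exact ⟨0, by simp [h0], fun x => by simpa [h0] using hf x⟩
    have hval : ∀ x : A →ₐ[ℝ] ℝ, x f = ∑ l, x (u l) ^ 2 := fun x => by simp [hu]
    have hval' : ∀ x : A →ₐ[ℝ] ℝ, x (algebraMap ℝ A (χ j f)⁻¹ * ∑ l, algebraMap ℝ A (χ j (u l)) * u l)
        = (χ j f)⁻¹ * ∑ l, χ j (u l) * x (u l) := fun x => by simp
    refine ⟨algebraMap ℝ A (χ j f)⁻¹ * ∑ l, algebraMap ℝ A (χ j (u l)) * u l, fun _ => ?_,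
      fun x => ?_⟩
    · rw [hval']
      simp only [← sq, ← hval]
      exact inv_mul_cancel₀ h0
    · have hpos : 0 < χ j f := (hf _).lt_of_ne' h0
      have hcs := Finset.sum_mul_sq_le_sq_mul_sq Finset.univ (fun l => χ j (u l)) fun l => x (u l)
      rw [← hval, ← hval] at hcs
      rw [hval', mul_pow, inv_pow, ← mul_assoc, ← div_eq_mul_inv, sq (χ j f), div_mul_cancel_left₀ h0,
        inv_mul_le_iff₀ hpos]
      exact hcs
  choose w hw1 hw2 using hw
  have hgw : ∀ k i, g k i * χ i (w i) = g k i := by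
    intro k i
    by_cases h0 : χ i f = 0
    · have : g k i ^ 2 = 0 :=
        (Finset.sum_eq_zero_iff_of_nonneg fun k _ => sq_nonneg (g k i)).1 ((hg i).symm.trans h0) k
          (Finset.mem_univ k)
      simp [pow_eq_zero_iff two_ne_zero |>.1 this]
    · rw [hw1 i h0, mul_one]
  -- One factor `p j` is split off for Cauchy-Schwarz against `∑ p_j² ≤ 1`.
  let h : κ → A := fun k => ∑ j, p j * (p j * (algebraMap ℝ A (g k j) * w j))
  have hh : ∀ (x : A →ₐ[ℝ] ℝ) k, x (h k) = ∑ j, x (p j) * (x (p j) * (g k j * x (w j))) :=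
    fun x k => by simp [h]
  have hpsd : IsPsd (f - ∑ k, h k ^ 2) := by
    rw [isPsd_iff]
    intro x
    rw [map_sub, sub_nonneg, map_sum]
    calc ∑ k, x (h k ^ 2) ≤ ∑ k, ∑ j, (x (p j) * (g k j * x (w j))) ^ 2 := by
          refine Finset.sum_le_sum fun k _ => ?_
          rw [map_pow, hh]
          refine (Finset.sum_mul_sq_le_sq_mul_sq _ _ _).trans ?_
          exact mul_le_of_le_one_left (by positivity) (hp1 x)
      _ = ∑ j, x (p j) ^ 2 * (χ j f * x (w j) ^ 2) := by
          rw [Finset.sum_comm]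
          refine Finset.sum_congr rfl fun j _ => ?_
          rw [hg, Finset.sum_mul, Finset.mul_sum]
          exact Finset.sum_congr rfl fun k _ => by ring
      _ ≤ ∑ j, x (p j) ^ 2 * x f :=
          Finset.sum_le_sum fun j _ => mul_le_mul_of_nonneg_left (hw2 j x) (sq_nonneg _)
      _ = (∑ j, x (p j) ^ 2) * x f := (Finset.sum_mul _ _ _).symm
      _ ≤ x f := mul_le_of_le_one_left (hf x) (hp1 x)
  obtain ⟨n, s, hs⟩ := hA _ hpsd
  refine ⟨h, n, s, by rw [← hs]; ring, fun k i => ?_⟩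
  rw [hh]
  simp [hp, hgw]


/-! ### Separation of points on virtually compact curves -/

/-- On a curve, a prime containing a function that vanishes on no component is maximal. -/
theorem isMaximal_of_forall_minimalPrimes_notMem {A : Type*} [CommRing A]
    (hdim : ∀ p ∈ minimalPrimes A, ringKrullDim (A ⧸ p) = 1) {c : A}
    (hc : ∀ p ∈ minimalPrimes A, c ∉ p) {q : Ideal A} (hq : q.IsPrime) (hcq : c ∈ q) :
    q.IsMaximal := by
  obtain ⟨p, hp, hpq⟩ := Ideal.exists_minimalPrimes_le (I := ⊥) (J := q) bot_le
  have hpp : p.IsPrime := hp.1.1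
  have : Ring.KrullDimLE 1 (A ⧸ p) := Ring.krullDimLE_iff.2 (hdim p hp).le
  have hs := Ideal.Quotient.mk_surjective (I := p)
  have hker : RingHom.ker (Ideal.Quotient.mk p) ≤ q := by rwa [Ideal.mk_ker]
  have hq' : (q.map (Ideal.Quotient.mk p)).IsPrime := Ideal.map_isPrime_of_surjective hs hker
  have hne : q.map (Ideal.Quotient.mk p) ≠ ⊥ := by
    intro h
    rw [Ideal.map_eq_bot_iff_le_ker, Ideal.mk_ker] at h
    exact hc p hp (h hcq)
  have hm := hq'.isMaximal_of_ne_bot hne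
  have := Ideal.comap_isMaximal_of_surjective _ hs (K := q.map (Ideal.Quotient.mk p))
  rwa [Ideal.comap_map_of_surjective' _ hs, sup_eq_left.2 hker] at this

/-- On a virtually compact curve there is a bounded function that is constant on no component. -/
theorem exists_mem_boundedFunctions_sub_notMem {A : Type*} [CommRing A] [Algebra ℝ A]
    [Algebra.FiniteType ℝ A] (hdim : ∀ p ∈ minimalPrimes A, ringKrullDim (A ⧸ p) = 1)
    (hB : ∀ p ∈ minimalPrimes A, boundedFunctions (A ⧸ p) ≠ ⊥) :
    ∃ b ∈ boundedFunctions A, ∀ p ∈ minimalPrimes A, ∀ β : ℝ, b - algebraMap ℝ A β ∉ p := by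
  classical
  have hA : IsNoetherianRing A := Algebra.FiniteType.isNoetherianRing ℝ A
  have hfin : (minimalPrimes A).Finite := minimalPrimes.finite_of_isNoetherianRing A
  have key : ∀ p ∈ minimalPrimes A, ∃ s : A, (∀ q ∈ minimalPrimes A, q ≠ p → s ∈ q) ∧
      Ideal.Quotient.mk p s ∈ boundedFunctions (A ⧸ p) ∧
      ∀ β : ℝ, s - algebraMap ℝ A β ∉ p := by
    intro p hp
    have hpp : p.IsPrime := hp.1.1
    obtain ⟨b, hbB, hb⟩ := exists_transcendental_mem_boundedFunctions (hdim p hp) (hB p hp)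
    obtain ⟨c, hc, hcp⟩ : ∃ c, (∀ q ∈ minimalPrimes A, q ≠ p → c ∈ q) ∧ c ∉ p := by
      by_contra! h
      have hle : (hfin.toFinset.erase p).inf id ≤ p := fun c hc =>
        h c fun q hq hqp => by
          rw [Submodule.mem_finsetInf] at hc
          exact hc q (by simp [hq, hqp])
      obtain ⟨q, hq, hqp⟩ := (Ideal.IsPrime.inf_le' hpp).1 hle
      rw [Finset.mem_erase, Set.Finite.mem_toFinset] at hq
      exact hq.1 (le_antisymm hqp (hp.2 hq.2.1 hqp))
    have hc0 : Ideal.Quotient.mk p c ≠ 0 := fun h => hcp (Ideal.Quotient.eq_zero_iff_mem.1 h)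
    have : Ring.KrullDimLE 1 (A ⧸ p) := Ring.krullDimLE_iff.2 (hdim p hp).le
    -- Modulo `c` the function `b` is algebraic, so some `F(b) = c d` on this component. Then `c d
    -- b` vanishes on the other components and equals `b F(b)` here: bounded, and nonconstant
    -- because `b` is transcendental.
    have hF : Module.Finite ℝ ((A ⧸ p) ⧸ Ideal.span {Ideal.Quotient.mk p c}) :=
      finite_quotient_span_singleton fun q hq hcq =>
        hq.isMaximal_of_ne_bot fun h => hc0 (by rwa [h, Ideal.mem_bot] at hcq)
    obtain ⟨F, hF0, hF⟩ : IsAlgebraic ℝ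
        (Ideal.Quotient.mkₐ ℝ (Ideal.span {Ideal.Quotient.mk p c}) b) :=
      (Algebra.IsIntegral.isIntegral _).isAlgebraic
    rw [Polynomial.aeval_algHom_apply, Ideal.Quotient.mkₐ_eq_mk, Ideal.Quotient.eq_zero_iff_mem,
      Ideal.mem_span_singleton] at hF
    obtain ⟨d, hd⟩ := hF
    obtain ⟨d, rfl⟩ := Ideal.Quotient.mk_surjective d
    obtain ⟨b', rfl⟩ := Ideal.Quotient.mk_surjective b
    have hs : Ideal.Quotient.mk p (c * d * b') =
        Polynomial.aeval (Ideal.Quotient.mk p b') (F * Polynomial.X) := by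
      simp [hd]
    refine ⟨c * d * b', fun q hq hqp => ?_, ?_, fun β hβ => ?_⟩
    · exact q.mul_mem_right _ (q.mul_mem_right _ (hc q hq hqp))
    · rw [hs]
      exact Algebra.adjoin_le (Set.singleton_subset_iff.2 hbB)
        (Polynomial.aeval_mem_adjoin_singleton ℝ _)
    · rw [← Ideal.Quotient.eq_zero_iff_mem, map_sub, hs] at hβ
      have h0 : Polynomial.aeval (Ideal.Quotient.mk p b')
          (F * Polynomial.X - Polynomial.C β) = 0 := by
        rw [map_sub, Polynomial.aeval_C]
        exact hβ
      have h1 := transcendental_iff.1 hb _ h0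
      have h2 : (F * Polynomial.X).natDegree = 0 := by
        rw [sub_eq_zero.1 h1, Polynomial.natDegree_C]
      rw [Polynomial.natDegree_mul_X hF0] at h2
      omega
  choose! s hs1 hs2 hs3 using key
  refine ⟨∑ q ∈ hfin.toFinset, s q, ?_, fun p hp β hβ => hs3 p hp β ?_⟩
  · have hc : ∀ p ∈ minimalPrimes A, ∃ c : ℝ, ∀ x : (A ⧸ p) →ₐ[ℝ] ℝ,
        |x (Ideal.Quotient.mk p (s p))| ≤ c := hs2
    choose! c hc using hc
    refine mem_boundedFunctions.2 ⟨∑ q ∈ hfin.toFinset, |c q|, fun x => ?_⟩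
    rw [map_sum]
    refine (Finset.abs_sum_le_sum_abs _ _).trans (Finset.sum_le_sum fun p hp => ?_)
    rw [Set.Finite.mem_toFinset] at hp
    by_cases hpx : p ≤ RingHom.ker x
    · exact (hc p hp (Ideal.Quotient.liftₐ p x hpx)).trans (le_abs_self _)
    · have hx : (RingHom.ker x).IsPrime := RingHom.ker_isPrime _
      obtain ⟨q, hq, hqx⟩ := Ideal.exists_minimalPrimes_le (I := ⊥) (J := RingHom.ker x) bot_le
      have : x (s p) = 0 := hqx (hs1 p hp q hq fun h => hpx (h ▸ hqx))
      simp [this]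
  · have hmem : ∑ q ∈ hfin.toFinset.erase p, s q ∈ p := by
      refine sum_mem fun q hq => ?_
      rw [Finset.mem_erase, Set.Finite.mem_toFinset] at hq
      exact hs1 q hq.2 p hp hq.1.symm
    rw [← Finset.add_sum_erase _ _ (hfin.mem_toFinset.2 hp)] at hβ
    have := p.sub_mem hβ hmem
    rwa [show ∀ a b c : A, a + b - c - b = a - c from fun a b c => by ring] at this

/-- A curve with a bounded function that is constant on no component is quasi-finite over its ring
of bounded functions at every real point. -/
theorem quasiFiniteAt_boundedFunctions {A : Type*} [CommRing A] [Algebra ℝ A]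
    [Algebra.FiniteType ℝ A] (hdim : ∀ p ∈ minimalPrimes A, ringKrullDim (A ⧸ p) = 1)
    {b : A} (hbB : b ∈ boundedFunctions A)
    (hb : ∀ p ∈ minimalPrimes A, ∀ β : ℝ, b - algebraMap ℝ A β ∉ p) (x : A →ₐ[ℝ] ℝ)
    [(RingHom.ker x).IsPrime] :
    Algebra.QuasiFiniteAt (boundedFunctions A) (RingHom.ker x) := by
  have hA : IsNoetherianRing A := Algebra.FiniteType.isNoetherianRing ℝ A
  have hft : Algebra.FiniteType (boundedFunctions A) A :=
    Algebra.FiniteType.of_restrictScalars_finiteType ℝ _ _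
  let c := b - algebraMap ℝ A (x b)
  have hcB : c ∈ boundedFunctions A := sub_mem hbB (algebraMap_mem _ _)
  have hcx : c ∈ RingHom.ker x := by simp [c, RingHom.mem_ker]
  have hmax : ∀ q : Ideal A, q.IsPrime → c ∈ q → q.IsMaximal := fun q hq hcq =>
    isMaximal_of_forall_minimalPrimes_notMem hdim (fun p hp => hb p hp _) hq hcq
  have hfinite : (PrimeSpectrum.zeroLocus {c}).Finite := by
    have := finite_quotient_span_singleton hmax
    have : IsArtinianRing (A ⧸ Ideal.span {c}) := IsArtinianRing.of_finite ℝ _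
    have hr := range_comap_of_surjective _ (Ideal.Quotient.mk (Ideal.span {c}))
      Ideal.Quotient.mk_surjective
    rw [Ideal.mk_ker, PrimeSpectrum.zeroLocus_span] at hr
    rw [← hr]
    exact Set.finite_range _
  let P : PrimeSpectrum A := ⟨RingHom.ker x, inferInstance⟩
  -- As `c` is itself bounded, the fibre through `x` lies in the finite zero set of `c`, whose
  -- points are closed; so the fibre is discrete.
  have hsub : PrimeSpectrum.comap (algebraMap (boundedFunctions A) A) ⁻¹'
      {P.comap (algebraMap (boundedFunctions A) A)} ⊆ PrimeSpectrum.zeroLocus {c} := by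
    intro q hq
    have hmem : (⟨c, hcB⟩ : boundedFunctions A) ∈
        (P.comap (algebraMap (boundedFunctions A) A)).asIdeal := hcx
    rw [← (hq : _ = _)] at hmem
    exact Set.singleton_subset_iff.2 hmem
  refine Algebra.QuasiFiniteAt.of_isOpen_singleton_fiber P ?_
  have := (hfinite.subset hsub).to_subtype
  have : T1Space (PrimeSpectrum.comap (algebraMap (boundedFunctions A) A) ⁻¹'
      {P.comap (algebraMap (boundedFunctions A) A)}) := by
    refine ⟨fun q => ?_⟩
    have h := (PrimeSpectrum.isClosed_singleton_iff_isMaximal q.1).2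
      (hmax _ q.1.2 (Set.singleton_subset_iff.1 (hsub q.2)))
    convert h.preimage continuous_subtype_val using 1
    ext y
    simp [Subtype.ext_iff]
  exact isOpen_discrete _

/-- Bounded functions on a virtually compact curve separate real points. -/
theorem exists_mem_boundedFunctions_ne_of_curve {A : Type*} [CommRing A] [Algebra ℝ A]
    [Algebra.FiniteType ℝ A] (hdim : ∀ p ∈ minimalPrimes A, ringKrullDim (A ⧸ p) = 1)
    (hB : ∀ p ∈ minimalPrimes A, boundedFunctions (A ⧸ p) ≠ ⊥) {x y : A →ₐ[ℝ] ℝ} (hxy : x ≠ y) :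
    ∃ b ∈ boundedFunctions A, x b ≠ y b := by
  obtain ⟨b, hbB, hb⟩ := exists_mem_boundedFunctions_sub_notMem hdim hB
  have hft : Algebra.FiniteType (boundedFunctions A) A :=
    Algebra.FiniteType.of_restrictScalars_finiteType ℝ _ _
  have hpr : (RingHom.ker y).IsPrime := RingHom.ker_isPrime _
  have := quasiFiniteAt_boundedFunctions hdim hbB hb y
  obtain ⟨t, hty, ht⟩ := Algebra.zariskisMainProperty_iff'.1
    (Algebra.ZariskisMainProperty.of_finiteType (R := boundedFunctions A) (RingHom.ker y))
  obtain ⟨h, hh⟩ : ∃ h, x h ≠ y h := by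
    by_contra! H
    exact hxy (AlgHom.ext H)
  -- The function `t^m (h - h(x))` is integral over the bounded functions, hence bounded; it
  -- vanishes at `x` but not at `y`.
  obtain ⟨m, hm⟩ := ht (h - algebraMap ℝ A (x h))
  refine ⟨_, mem_boundedFunctions_of_isIntegral hm, ?_⟩
  simp only [map_mul, map_pow, map_sub, AlgHom.commutes, Algebra.algebraMap_self, RingHom.id_apply,
    sub_self, mul_zero]
  exact (mul_ne_zero (pow_ne_zero _ hty) (sub_ne_zero.2 hh.symm)).symm

/-- Bounded functions separate the real points of a variety that is compact or a virtually compact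
curve. -/
theorem exists_mem_boundedFunctions_ne {A : Type*} [CommRing A] [Algebra ℝ A]
    [Algebra.FiniteType ℝ A]
    (hA : CompactSpace (RealPoints A) ∨ (IsCurve A ∧ IsVirtuallyCompact A))
    {x y : A →ₐ[ℝ] ℝ} (hxy : x ≠ y) : ∃ b ∈ boundedFunctions A, x b ≠ y b := by
  obtain hA | ⟨hdim, hB⟩ := hA
  · rw [boundedFunctions_eq_top_of_compactSpace]
    by_contra! H
    exact hxy (AlgHom.ext fun a => H a trivial)
  · refine exists_mem_boundedFunctions_ne_of_curve ?_ ?_ hxy <;> intro p hp <;>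
      rw [← PrimeSpectrum.vanishingIdeal_irreducibleComponents] at hp <;>
      obtain ⟨Z, hZ, rfl⟩ := hp
    · exact hdim Z hZ
    · exact hB Z hZ

/-! ### Gluing along the intersection -/

/-- The evaluation homomorphism at a point with residue field `ℝ`. -/
theorem IsRealPoint.exists_algHom {A : Type*} [CommRing A] [Algebra ℝ A] {P : PrimeSpectrum A}
    (hP : IsRealPoint P) : ∃ x : A →ₐ[ℝ] ℝ, ∀ a, x a = 0 ↔ a ∈ P.asIdeal := by
  refine ⟨(AlgEquiv.ofBijective (Algebra.ofId ℝ P.asIdeal.ResidueField) hP).symm.toAlgHom.comp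
    (IsScalarTower.toAlgHom ℝ A P.asIdeal.ResidueField), fun a => ?_⟩
  simp

end RealVariety

theorem mainTheorem4 {A : Type*} [CommRing A] [Algebra ℝ A] [Algebra.FiniteType ℝ A] [IsReduced A]
    (V₁ V₂ : Set (PrimeSpectrum A)) (hV₁ : IsClosed V₁) (hV₂ : IsClosed V₂)
    (hV : V₁ ∪ V₂ = Set.univ)
    (hpsd : RealVariety.PsdEqSos (RealVariety.CoordRing V₁))
    (hcpt : CompactSpace (RealVariety.RealPoints (RealVariety.CoordRing V₁)) ∨
      (RealVariety.IsCurve (RealVariety.CoordRing V₁) ∧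
        RealVariety.IsVirtuallyCompact (RealVariety.CoordRing V₁)))
    (hfin : (V₁ ∩ V₂).Finite)
    (htrans : RealVariety.IsTransversal V₁ V₂)
    (hreal : ∀ P ∈ V₁ ∩ V₂, RealVariety.IsRealPoint P) :
    ∀ f : A, RealVariety.IsPsd f → RealVariety.IsSos (RealVariety.restrict V₂ f) →
      RealVariety.IsSos f := by
  classical
  rintro f hf ⟨N, g, hg⟩
  have hfin' : Fintype ↥(V₁ ∩ V₂) := hfin.fintype
  set I₁ := PrimeSpectrum.vanishingIdeal V₁ with hI₁
  set I₂ := PrimeSpectrum.vanishingIdeal V₂ with hI₂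
  have hinf : ∀ a ∈ I₁, a ∈ I₂ → a = 0 := by
    intro a h1 h2
    have : a ∈ PrimeSpectrum.vanishingIdeal (V₁ ∪ V₂) := by
      rw [PrimeSpectrum.vanishingIdeal_union]
      exact ⟨h1, h2⟩
    rw [hV, PrimeSpectrum.vanishingIdeal_univ, nilradical_eq_zero] at this
    exact this
  choose g' hg' using fun k => Ideal.Quotient.mk_surjective (I := I₂) (g k)
  have hg2 : f - ∑ k, g' k ^ 2 ∈ I₂ := by
    rw [← Ideal.Quotient.eq_zero_iff_mem, map_sub, map_sum, sub_eq_zero]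
    simp only [map_pow, hg']
    exact hg
  choose χ hχ using fun P : ↥(V₁ ∩ V₂) => (hreal P P.2).exists_algHom
  have hχ1 : ∀ P, ∀ a ∈ I₁, χ P a = 0 := fun P a ha =>
    (hχ P a).2 ((PrimeSpectrum.mem_vanishingIdeal _ _).1 ha P P.2.1)
  have hχ2 : ∀ P, ∀ a ∈ I₂, χ P a = 0 := fun P a ha =>
    (hχ P a).2 ((PrimeSpectrum.mem_vanishingIdeal _ _).1 ha P P.2.2)
  have hsplit : ∀ a, (∀ P, χ P a = 0) → ∃ b ∈ I₂, a - b ∈ I₁ := by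
    intro a ha
    have : a ∈ I₁ ⊔ I₂ := by
      rw [hI₁, hI₂, htrans]
      simp only [Submodule.mem_iInf]
      exact fun P hP => (hχ ⟨P, hP⟩ a).1 (ha ⟨P, hP⟩)
    obtain ⟨c, hc, b, hb, rfl⟩ := Submodule.mem_sup.1 this
    exact ⟨b, hb, by simpa using hc⟩
  let ψ : ↥(V₁ ∩ V₂) → (A ⧸ I₁) →ₐ[ℝ] ℝ := fun P => Ideal.Quotient.liftₐ I₁ (χ P) (hχ1 P)
  have hψ : ∀ P a, ψ P (Ideal.Quotient.mk I₁ a) = χ P a := fun P a => rfl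
  have hψne : ∀ P Q, P ≠ Q → ψ P ≠ ψ Q := by
    intro P Q hPQ h
    refine hPQ (Subtype.ext (PrimeSpectrum.ext (Ideal.ext fun a => ?_)))
    rw [← hχ, ← hχ, ← hψ, ← hψ, h]
  have hpsd1 : RealVariety.IsPsd (Ideal.Quotient.mk I₁ f) :=
    RealVariety.isPsd_iff.2 fun x => RealVariety.isPsd_iff.1 hf (x.comp (Ideal.Quotient.mkₐ ℝ I₁))
  have hval : ∀ P, χ P f = ∑ k, χ P (g' k) ^ 2 := by
    intro P
    have := hχ2 P _ hg2
    rwa [map_sub, map_sum, sub_eq_zero, Finset.sum_congr rfl fun k _ => map_pow (χ P) _ _] at this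
  obtain ⟨h, n, s, hhs, hh⟩ := RealVariety.exists_sum_sq_add_sum_sq_of_isPsd hpsd ψ
    (fun P Q hPQ => RealVariety.exists_mem_boundedFunctions_ne hcpt (hψne P Q hPQ)) hpsd1
    (fun k P => χ P (g' k)) hval
  choose h' hh' using fun k => Ideal.Quotient.mk_surjective (I := I₁) (h k)
  choose s' hs' using fun l => Ideal.Quotient.mk_surjective (I := I₁) (s l)
  have hs0 : ∀ l P, χ P (s' l) = 0 := by
    intro l P
    have h1 := congrArg (ψ P) hhs
    simp only [hψ, hval, map_add, map_sum, map_pow, hh, ← hs', left_eq_add] at h1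
    exact pow_eq_zero_iff two_ne_zero |>.1
      ((Finset.sum_eq_zero_iff_of_nonneg fun l _ => sq_nonneg _).1 h1 l (Finset.mem_univ l))
  -- `u l` is `s l` on `V₁` and `0` on `V₂`; below, `g' k + v k` is `h k` on `V₁` and `g k` on `V₂`.
  choose u hu2 hu1 using fun l => hsplit (s' l) (hs0 l)
  choose v hv2 hv1 using fun k => hsplit (h' k - g' k) fun P => by
    rw [map_sub, ← hψ, hh', hh, sub_self]
  have key : f = ∑ k, (g' k + v k) ^ 2 + ∑ l, u l ^ 2 := by
    refine sub_eq_zero.1 (hinf _ ?_ ?_)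
    · rw [← Ideal.Quotient.eq_zero_iff_mem, map_sub, sub_eq_zero, hhs]
      have e1 : ∀ k, Ideal.Quotient.mk I₁ (g' k + v k) = h k := fun k => by
        rw [← hh', eq_comm, Ideal.Quotient.eq, ← sub_sub]
        exact hv1 k
      have e2 : ∀ l, Ideal.Quotient.mk I₁ (u l) = s l := fun l => by
        rw [← hs', eq_comm, Ideal.Quotient.eq]
        exact hu1 l
      simp only [map_add, map_sum, map_pow, e2, ← e1]
    · have e1 : ∀ k, Ideal.Quotient.mk I₂ (v k) = 0 := fun k =>
        Ideal.Quotient.eq_zero_iff_mem.2 (hv2 k)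
      have e2 : ∀ l, Ideal.Quotient.mk I₂ (u l) = 0 := fun l =>
        Ideal.Quotient.eq_zero_iff_mem.2 (hu2 l)
      rw [← Ideal.Quotient.eq_zero_iff_mem] at hg2 ⊢
      rw [← hg2]
      simp [e1, e2]
  refine ⟨N + n, Fin.append (fun k => g' k + v k) u, ?_⟩
  rw [Fin.sum_univ_add, key]
  simp
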